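/- Let $F$ be a field and let $R = F\langle e,y\rangle/(e^2-e)$ be the free associative unital $F$-algebra on two noncommuting variables $e,y$ modulo the relation $e^2=e$. For $n\ge 1$ let $P_n$ be the two-sided ideal of $R$ generated by $eye, ey^2e,\dots,ey^{n-1}e$ (so $P_1=0$). Then every $P_n$ with $n\ge 1$ is a prime ideal and is both left and right primitive (that is, it is the annihilator of a simple left $R$-module and also of a simple right $R$-module), and $P_1\subsetneq P_2\subsetneq P_3\subsetneq\cdots$. The union $U=\bigcup_{n\ge 1}P_n$ is a two-sided ideal, and $U=ReyReR=ReRyeR$, where $RaRbR$ denotes the additive span of all products $rasbt$ with $r,s,t\in R$. Moreover $(ReyR)^2\subseteq U$ and $ey\notin U$, and $U$ is not semiprime (an ideal $I$ is semiprime if $aRa\subseteq I$ implies $a\in I$ for all $a\in R$). -/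

import Mathlib

universe u

namespace ChainEx

/-- The two free variables `e` and `y`. -/
inductive Var : Type
  | e
  | y

/-- The single relation `e * e = e` on the free algebra `F⟨e, y⟩`. -/
inductive IdemRel (F : Type u) [Field F] : FreeAlgebra F Var → FreeAlgebra F Var → Prop
  | idem : IdemRel F (FreeAlgebra.ι F Var.e * FreeAlgebra.ι F Var.e) (FreeAlgebra.ι F Var.e)

/-- The `F`-algebra `R = F⟨e, y⟩ / (e² - e)`. -/
abbrev IdemAlg (F : Type u) [Field F] : Type u := RingQuot (IdemRel F)

/-- The image of the variable `e` in `R`. -/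
noncomputable def e (F : Type u) [Field F] : IdemAlg F :=
  RingQuot.mkAlgHom F (IdemRel F) (FreeAlgebra.ι F Var.e)

/-- The image of the variable `y` in `R`. -/
noncomputable def y (F : Type u) [Field F] : IdemAlg F :=
  RingQuot.mkAlgHom F (IdemRel F) (FreeAlgebra.ι F Var.y)

/-- The two-sided ideal `P n` of `R` generated by `e y e, e y² e, …, e yⁿ⁻¹ e`. -/
noncomputable def P (F : Type u) [Field F] (n : ℕ) : TwoSidedIdeal (IdemAlg F) :=
  TwoSidedIdeal.span {a | ∃ i : ℕ, 1 ≤ i ∧ i < n ∧ a = e F * y F ^ i * e F}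

/-- A two-sided ideal `I` of a ring is prime if it is proper and
`a R b ⊆ I` implies `a ∈ I` or `b ∈ I`. -/
def IsPrime {R : Type u} [Ring R] (I : TwoSidedIdeal R) : Prop :=
  I ≠ ⊤ ∧ ∀ a b : R, (∀ r : R, a * r * b ∈ I) → a ∈ I ∨ b ∈ I

/-- A two-sided ideal `I` of a ring is semiprime if `a R a ⊆ I` implies `a ∈ I`. -/
def IsSemiprime {R : Type u} [Ring R] (I : TwoSidedIdeal R) : Prop :=
  ∀ a : R, (∀ r : R, a * r * a ∈ I) → a ∈ I

/-- A two-sided ideal is left primitive if it is the annihilator of a simple left module.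
(Simple modules are quotients of the ring, so the universe is no restriction.) -/
def IsLeftPrimitive {R : Type u} [Ring R] (I : TwoSidedIdeal R) : Prop :=
  ∃ (M : Type u) (_ : AddCommGroup M) (_ : Module R M),
    IsSimpleModule R M ∧ ∀ r : R, r ∈ I ↔ r ∈ Module.annihilator R M

/-- A two-sided ideal is right primitive if it is the annihilator of a simple right module,
that is, of a simple module over the opposite ring. -/
def IsRightPrimitive {R : Type u} [Ring R] (I : TwoSidedIdeal R) : Prop :=
  ∃ (M : Type u) (_ : AddCommGroup M) (_ : Module Rᵐᵒᵖ M),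
    IsSimpleModule Rᵐᵒᵖ M ∧ ∀ r : R, r ∈ I ↔ MulOpposite.op r ∈ Module.annihilator Rᵐᵒᵖ M

/-- `R a R`, the span of all products `r * a * s`, as a product of `F`-subspaces of `R`. -/
noncomputable def sandwich₁ (F : Type u) [Field F] (a : IdemAlg F) : Submodule F (IdemAlg F) :=
  ⊤ * Submodule.span F {a} * ⊤

/-- `R a R b R`, the span of all products `r * a * s * b * t`, as a product of
`F`-subspaces of `R`. -/
noncomputable def sandwich₂ (F : Type u) [Field F] (a b : IdemAlg F) :
    Submodule F (IdemAlg F) :=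
  ⊤ * Submodule.span F {a} * ⊤ * Submodule.span F {b} * ⊤

end ChainEx

/-!
The ideal `P n` is exhibited as the annihilator of an explicit simple module. Let `M` have the
basis `y ^ i • w v` (`i v : ℕ`), with `y` shifting `i`, and let `e` project onto the span of the
`w v`, sending `y ^ i • w v` to `w (T i v)` or to `0`, where `T 0 v = v` and `T i v` is undefined
for `1 ≤ i < n`. This makes `e` idempotent and kills `P n`. For `i ≥ n` the partial function `T` is
chosen to serve two purposes.

* If `i < v`, then `T i v` is a fresh index, larger than `v`
  and determining `(i, v)`. So the words
  `y ^ a * e * y ^ b₁ * e * ⋯ * e * y ^ bₖ` (all `bⱼ` but the last `≥ n`) take `y ^ n • w u`, with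
  `u` large compared with the exponents, to pairwise distinct basis vectors. These words
  span `R` modulo `P n`, hence the annihilator of `M` is `P n`
  (`rep_eq_zero_iff`).
* If `v ≤ i`, then `T i v` is defined only when `i` is one of the sparse exponents
  `2 ^ pair (pair v b) t`, and then it is `b`. As there are infinitely many of these for each pair
  `(v, b)` and large gaps between them, for a nonzero `m` and any `b` some `e * y ^ j` takes `m`
  to a nonzero multiple of `w b`; hence `M` is simple (`rep_transitive`).

The anti-automorphism of `R` fixing `e` and `y` preserves `P n` and turns left primitivity into
right primitivity; primitive ideals are prime. The same modules separate the ideals: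
`e * y ^ m * e` does not kill the module for `P m`, and `e * y` kills none of them, so `e * y` is
not in the union `U`. Finally `e * s * e` lies in `U` as soon as the product `s` has a factor
`y` at either end (`corner_mem`), which gives the descriptions of `U` and
`(e * y) * R * (e * y) ⊆ U`.
-/

namespace ChainEx

/-! ### Simple modules and primitive ideals over an arbitrary ring -/

section General

variable {S : Type*} [Ring S] {M : Type*} [AddCommGroup M]

theorem isSimpleModule_compHom {E : Type*} [Ring E] [Module E M] [Nontrivial M] (φ : S →+* E)
    (h : ∀ m : M, m ≠ 0 → ∀ m' : M, ∃ s, φ s • m = m') :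
    @IsSimpleModule S _ M _ (Module.compHom M φ) := by
  let := Module.compHom M φ
  rw [isSimpleModule_iff_toSpanSingleton_surjective]
  exact ⟨inferInstance, fun m hm m' => h m hm m'⟩

theorem IsLeftPrimitive.isPrime {R : Type u} [Ring R] {I : TwoSidedIdeal R}
    (hI : IsLeftPrimitive I) : IsPrime I := by
  obtain ⟨M, _, _, hM, hI⟩ := hI
  have := hM.nontrivial
  simp only [Module.mem_annihilator] at hI
  refine ⟨?_, fun a b hab => ?_⟩
  · rintro rfl
    obtain ⟨m, hm⟩ := exists_ne (0 : M)
    exact hm (by simpa using (hI 1).1 trivial m)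
  · by_contra! hcon
    obtain ⟨ha, hb⟩ := hcon
    simp only [hI, not_forall] at ha hb
    obtain ⟨p, hp⟩ := ha
    obtain ⟨q, hq⟩ := hb
    obtain ⟨r, hr⟩ := IsSimpleModule.toSpanSingleton_surjective R hq p
    rw [LinearMap.toSpanSingleton_apply] at hr
    apply hp
    simpa [← hr, mul_smul] using (hI _).1 (hab r) q

end General

/-! ### The algebra `R` and its anti-automorphism -/

variable (F : Type u) [Field F]

theorem e_mul_e : e F * e F = e F := by
  rw [e, ← map_mul]
  exact RingQuot.mkAlgHom_rel F IdemRel.idem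

/-- The homomorphism from `R` determined by an idempotent `a` and an arbitrary element `b`. -/
noncomputable def lift {A : Type*} [Ring A] [Algebra F A] (a b : A) (ha : a * a = a) :
    IdemAlg F →ₐ[F] A :=
  RingQuot.liftAlgHom F ⟨FreeAlgebra.lift F (fun x => Var.casesOn x a b), by
    rintro _ _ ⟨⟩
    simpa using ha⟩

section Lift

variable {A : Type*} [Ring A] [Algebra F A] (a b : A) (ha : a * a = a)

@[simp]
theorem lift_e : lift F a b ha (e F) = a := by
  rw [lift, e, RingQuot.liftAlgHom_mkAlgHom_apply, FreeAlgebra.lift_ι_apply]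

@[simp]
theorem lift_y : lift F a b ha (y F) = b := by
  rw [lift, y, RingQuot.liftAlgHom_mkAlgHom_apply, FreeAlgebra.lift_ι_apply]

end Lift

variable {F} in
theorem mem_of_mul_left_closed {N : Submodule F (IdemAlg F)} (h1 : 1 ∈ N)
    (he : ∀ x ∈ N, e F * x ∈ N) (hy : ∀ x ∈ N, y F * x ∈ N) (r : IdemAlg F) : r ∈ N := by
  suffices h : ∀ x ∈ N, r * x ∈ N by simpa using h 1 h1
  obtain ⟨r, rfl⟩ := RingQuot.mkAlgHom_surjective F (IdemRel F) r
  induction r using FreeAlgebra.induction with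
  | grade0 c =>
    intro x hx
    rw [AlgHom.commutes, ← Algebra.smul_def]
    exact N.smul_mem c hx
  | grade1 v =>
    cases v
    · exact he
    · exact hy
  | mul a b ha hb =>
    intro x hx
    rw [map_mul, mul_assoc]
    exact ha _ (hb x hx)
  | add a b ha hb =>
    intro x hx
    rw [map_add, add_mul]
    exact N.add_mem (ha x hx) (hb x hx)

/-- The anti-endomorphism of `R` fixing `e` and `y`, as a homomorphism to the opposite ring. -/
noncomputable def rev : IdemAlg F →ₐ[F] (IdemAlg F)ᵐᵒᵖ :=
  lift F (MulOpposite.op (e F)) (MulOpposite.op (y F)) (by rw [← MulOpposite.op_mul, e_mul_e])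

theorem unop_rev_unop_rev (r : IdemAlg F) : (rev F (rev F r).unop).unop = r := by
  let g : IdemAlg F →ₗ[F] IdemAlg F :=
    (MulOpposite.opLinearEquiv F).symm.toLinearMap ∘ₗ (rev F).toLinearMap
  have hg : ∀ r, g r = (rev F r).unop := fun _ => rfl
  have := mem_of_mul_left_closed (N := LinearMap.eqLocus (g ∘ₗ g) LinearMap.id)
    (by simp [hg, rev])
    (by intro x hx; simpa [hg, rev] using congrArg (e F * ·) hx)
    (by intro x hx; simpa [hg, rev] using congrArg (y F * ·) hx) r
  simpa [hg] using this

/-! ### The ideals `P n` -/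

variable {F} in
theorem generator_mem_P {n i : ℕ} (h1 : 1 ≤ i) (hn : i < n) : e F * y F ^ i * e F ∈ P F n :=
  TwoSidedIdeal.subset_span ⟨i, h1, hn, rfl⟩

variable {F} in
theorem P_le_iff {n : ℕ} {I : TwoSidedIdeal (IdemAlg F)} :
    P F n ≤ I ↔ ∀ i, 1 ≤ i → i < n → e F * y F ^ i * e F ∈ I := by
  rw [P, TwoSidedIdeal.span_le]
  constructor
  · exact fun h i h1 h2 => h ⟨i, h1, h2, rfl⟩
  · rintro h _ ⟨i, h1, h2, rfl⟩
    exact h i h1 h2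

theorem P_mono : Monotone (P F) := fun _ _ h =>
  P_le_iff.2 fun _ h1 h2 => generator_mem_P h1 (h2.trans_le h)

theorem unop_rev_mem_P_iff (n : ℕ) (r : IdemAlg F) : (rev F r).unop ∈ P F n ↔ r ∈ P F n := by
  have h : ∀ r ∈ P F n, (rev F r).unop ∈ P F n := by
    have : P F n ≤ (P F n).op.comap (rev F) := P_le_iff.2 fun i h1 h2 => by
      simpa [TwoSidedIdeal.mem_comap, TwoSidedIdeal.mem_op_iff, rev, mul_assoc] using
        generator_mem_P (F := F) h1 h2
    intro r hr
    simpa [TwoSidedIdeal.mem_comap, TwoSidedIdeal.mem_op_iff] using this hr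
  exact ⟨fun hr => by simpa [unop_rev_unop_rev] using h _ hr, h r⟩

/-! ### The module -/

/-- The partial function through which `e` acts on the module: `e • (y ^ i • w v) = w (T n i v)`,
read as `0` where `T n i v` is undefined. -/
def T (n i v : ℕ) : Option ℕ :=
  if i = 0 then some v
  else if i < n then none
  else if i < v then some (Nat.pair i v + 1)
  else if i = 2 ^ Nat.log 2 i ∧ (Nat.unpair (Nat.unpair (Nat.log 2 i)).1).1 = v then
    some (Nat.unpair (Nat.unpair (Nat.log 2 i)).1).2
  else none

theorem T_zero (n v : ℕ) : T n 0 v = some v := by simp [T]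

theorem T_of_lt {n i : ℕ} (v : ℕ) (h1 : 1 ≤ i) (h : i < n) : T n i v = none := by
  simp [T, h, Nat.one_le_iff_ne_zero.1 h1]

theorem T_fresh {n i v : ℕ} (h1 : 1 ≤ i) (hn : n ≤ i) (hv : i < v) :
    T n i v = some (Nat.pair i v + 1) := by
  simp [T, hv, hn.not_gt, Nat.one_le_iff_ne_zero.1 h1]

theorem T_two_pow {n v b t : ℕ} (hn : n ≤ 2 ^ Nat.pair (Nat.pair v b) t)
    (hv : v ≤ 2 ^ Nat.pair (Nat.pair v b) t) :
    T n (2 ^ Nat.pair (Nat.pair v b) t) v = some b := by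
  simp [T, hn.not_gt, hv.not_gt, Nat.log_pow]

theorem T_eq_none {n i v : ℕ} (h1 : 1 ≤ i) (hv : v ≤ i)
    (h : ∀ b t, i ≠ 2 ^ Nat.pair (Nat.pair v b) t) : T n i v = none := by
  have : ¬ (i = 2 ^ Nat.log 2 i ∧ (Nat.unpair (Nat.unpair (Nat.log 2 i)).1).1 = v) := by
    rintro ⟨h2, rfl⟩
    apply h (Nat.unpair (Nat.unpair (Nat.log 2 i)).1).2 (Nat.unpair (Nat.log 2 i)).2
    simpa using h2
  simp [T, hv.not_gt, Nat.one_le_iff_ne_zero.1 h1, this]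

/-- The underlying space of the module; `(i, v)` is the index of the basis vector `y ^ i • w v`. -/
abbrev Mod : Type u := ℕ × ℕ →₀ F

/-- The action of `e` on a basis vector. -/
noncomputable def eBasis (n : ℕ) (p : ℕ × ℕ) : Mod F :=
  (T n p.1 p.2).elim 0 fun v => Finsupp.single (0, v) 1

/-- The action of `e`. -/
noncomputable def eOp (n : ℕ) : Module.End F (Mod F) := Finsupp.linearCombination F (eBasis F n)

/-- The action of `y`. -/
noncomputable def yOp : Module.End F (Mod F) :=
  Finsupp.lmapDomain F F fun p : ℕ × ℕ => (p.1 + 1, p.2)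

theorem eOp_single (n : ℕ) (p : ℕ × ℕ) (c : F) :
    eOp F n (Finsupp.single p c) = c • eBasis F n p := by
  simp [eOp]

theorem eOp_eBasis (n : ℕ) (p : ℕ × ℕ) : eOp F n (eBasis F n p) = eBasis F n p := by
  unfold eBasis
  cases T n p.1 p.2 with
  | none => simp
  | some v => simp [eOp_single, eBasis, T_zero]

theorem eOp_mul_eOp (n : ℕ) : eOp F n * eOp F n = eOp F n := by
  refine Finsupp.lhom_ext fun p c => ?_
  simp [Module.End.mul_apply, eOp_single, eOp_eBasis]

theorem yOp_single (p : ℕ × ℕ) (c : F) :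
    yOp F (Finsupp.single p c) = Finsupp.single (p.1 + 1, p.2) c := by
  simp [yOp]

theorem yOp_pow_single (j : ℕ) (p : ℕ × ℕ) (c : F) :
    (yOp F ^ j) (Finsupp.single p c) = Finsupp.single (p.1 + j, p.2) c := by
  induction j with
  | zero => simp
  | succ j ih => rw [pow_succ', Module.End.mul_apply, ih, yOp_single, add_assoc]

/-- The representation of `R` on the module for `P n`. -/
noncomputable def rep (n : ℕ) : IdemAlg F →ₐ[F] Module.End F (Mod F) :=
  lift F (eOp F n) (yOp F) (eOp_mul_eOp F n)

@[simp]
theorem rep_e (n : ℕ) : rep F n (e F) = eOp F n := lift_e ..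

@[simp]
theorem rep_y (n : ℕ) : rep F n (y F) = yOp F := lift_y ..

variable {F} in
theorem rep_eq_zero_of_mem {n : ℕ} {r : IdemAlg F} (hr : r ∈ P F n) : rep F n r = 0 := by
  have : P F n ≤ TwoSidedIdeal.ker (rep F n) := P_le_iff.2 fun i h1 h2 => by
    rw [TwoSidedIdeal.mem_ker]
    refine Finsupp.lhom_ext fun p c => ?_
    simp only [map_mul, map_pow, rep_e, rep_y, Module.End.mul_apply, eOp_single, map_smul]
    unfold eBasis
    cases T n p.1 p.2 with
    | none => simp
    | some v => simp [eOp_single, yOp_pow_single, eBasis, T_of_lt _ h1 h2]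
  exact (TwoSidedIdeal.mem_ker _).1 (this hr)

/-! ### Simplicity -/

theorem rep_e_mul_y_pow (n j : ℕ) (m : Mod F) :
    rep F n (e F * y F ^ j) m = m.sum fun p c => c • eBasis F n (p.1 + j, p.2) := by
  conv_lhs => rw [← m.sum_single, map_finsuppSum]
  refine Finsupp.sum_congr fun p _ => ?_
  simp [yOp_pow_single, eOp_single]

/-- Powers of `2` have large gaps. -/
theorem two_pow_eq_of_near {k K d : ℕ} (hd : 2 * d < 2 ^ K) (h1 : 2 ^ k ≤ 2 ^ K + d)
    (h2 : 2 ^ K ≤ 2 ^ k + d) : k = K := by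
  rcases lt_trichotomy k K with h | h | h
  · have := Nat.pow_le_pow_right (n := 2) (by norm_num) (Nat.succ_le_of_lt h)
    rw [Nat.succ_eq_add_one, pow_succ] at this
    omega
  · exact h
  · have := Nat.pow_le_pow_right (n := 2) (by norm_num) (Nat.succ_le_of_lt h)
    rw [Nat.succ_eq_add_one, pow_succ] at this
    omega

variable {F} in
theorem exists_rep_eq_single {n : ℕ} {m : Mod F} (hm : m ≠ 0) (b : ℕ) :
    ∃ r, rep F n r m = Finsupp.single (0, b) 1 := by
  obtain ⟨⟨j, a⟩, hja⟩ := Finsupp.support_nonempty_iff.2 hm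
  obtain ⟨d, hd⟩ : ∃ d, ∀ p ∈ m.support, p.1 + p.2 ≤ d :=
    ⟨m.support.sup fun p => p.1 + p.2, fun p hp => Finset.le_sup (f := fun p => p.1 + p.2) hp⟩
  have hjad := hd _ hja
  -- `2 ^ K` is a place where `T` sends `a` to `b`, far from zero and from the other such places.
  obtain ⟨K, hK⟩ : ∃ K, K = Nat.pair (Nat.pair a b) (2 * d + n + 1) := ⟨_, rfl⟩
  have hbig : 2 * d + n + 1 < 2 ^ K :=
    (hK ▸ Nat.right_le_pair _ _ : 2 * d + n + 1 ≤ K).trans_lt Nat.lt_two_pow_self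
  have key : rep F n (e F * y F ^ (2 ^ K - j)) m = m (j, a) • Finsupp.single (0, b) 1 := by
    rw [rep_e_mul_y_pow, Finsupp.sum, Finset.sum_eq_single (j, a)]
    · have : j + (2 ^ K - j) = 2 ^ K := by dsimp only at hjad; omega
      have hT : T n (2 ^ K) a = some b := by
        rw [hK] at hbig ⊢
        exact T_two_pow (by omega) (by dsimp only at hjad; omega)
      simp [eBasis, this, hT]
    · rintro ⟨i, v⟩ hiv hne
      have hivd := hd _ hiv
      dsimp only at hjad hivd
      have hT : T n (i + (2 ^ K - j)) v = none := by
        refine T_eq_none (by omega) (by omega) fun b' t h => hne ?_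
        have hk := two_pow_eq_of_near (k := Nat.pair (Nat.pair v b') t) (K := K) (d := d)
          (by omega) (by omega) (by omega)
        have hij : i = j := by rw [hk] at h; omega
        rw [hK, Nat.pair_eq_pair, Nat.pair_eq_pair] at hk
        rw [hij, hk.1.1]
      simp [eBasis, hT]
    · exact fun h => absurd hja h
  refine ⟨(m (j, a))⁻¹ • (e F * y F ^ (2 ^ K - j)), ?_⟩
  rw [map_smul, LinearMap.smul_apply, key, smul_smul,
    inv_mul_cancel₀ (Finsupp.mem_support_iff.1 hja), one_smul]

variable {F} in
theorem rep_transitive {n : ℕ} {m : Mod F} (hm : m ≠ 0) (m' : Mod F) :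
    ∃ r, rep F n r m = m' := by
  induction m' using Finsupp.induction_linear with
  | zero => exact ⟨0, by simp⟩
  | add f g hf hg =>
    obtain ⟨r, rfl⟩ := hf
    obtain ⟨s, rfl⟩ := hg
    exact ⟨r + s, by simp⟩
  | single p c =>
    obtain ⟨r, hr⟩ := exists_rep_eq_single (n := n) hm p.2
    refine ⟨c • (y F ^ p.1 * r), ?_⟩
    simp [hr, yOp_pow_single]

/-! ### Faithfulness modulo `P n` -/

/-- The word `y ^ a * e * y ^ b₁ * ⋯ * e * y ^ bₖ` encoded as `(a, [b₁, …, bₖ])`. -/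
noncomputable def word (w : ℕ × List ℕ) : IdemAlg F :=
  y F ^ w.1 * (w.2.map fun b => e F * y F ^ b).prod

/-- The codes of the words in which every inner power of `y` has exponent at least `n`. -/
def reduced (n : ℕ) : Set (ℕ × List ℕ) := {w | ∀ b ∈ w.2.dropLast, n ≤ b}

variable {F} in
/-- Reduced words span `R` modulo `P n`. -/
theorem exists_word_span_add (n : ℕ) (r : IdemAlg F) :
    ∃ s ∈ Submodule.span F (word F '' reduced n), ∃ p ∈ P F n, s + p = r := by
  let N : Submodule F (IdemAlg F) := (P F n).asIdeal.restrictScalars F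
  have hN : ∀ {x}, x ∈ N ↔ x ∈ P F n := TwoSidedIdeal.mem_asIdeal
  have hword : ∀ w ∈ reduced n, word F w ∈ Submodule.span F (word F '' reduced n) ⊔ N :=
    fun w hw => Submodule.mem_sup_left (Submodule.subset_span ⟨w, hw, rfl⟩)
  have closed : ∀ a : IdemAlg F,
      (∀ w ∈ reduced n, a * word F w ∈ Submodule.span F (word F '' reduced n) ⊔ N) →
      ∀ x ∈ Submodule.span F (word F '' reduced n) ⊔ N,
        a * x ∈ Submodule.span F (word F '' reduced n) ⊔ N := by
    intro a ha
    suffices Submodule.span F (word F '' reduced n) ⊔ N ≤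
        (Submodule.span F (word F '' reduced n) ⊔ N).comap (LinearMap.mulLeft F a) from
      fun x hx => this hx
    refine sup_le (Submodule.span_le.2 ?_) fun x hx => ?_
    · rintro _ ⟨w, hw, rfl⟩
      exact ha w hw
    · exact Submodule.mem_sup_right (hN.2 (TwoSidedIdeal.mul_mem_left _ _ _ (hN.1 hx)))
  have main := mem_of_mul_left_closed (N := Submodule.span F (word F '' reduced n) ⊔ N)
    (by simpa [word] using hword (0, []) (by simp [reduced]))
    (closed _ ?_) (closed _ ?_) r
  · obtain ⟨s, hs, p, hp, h⟩ := Submodule.mem_sup.1 main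
    exact ⟨s, hs, p, hN.1 hp, h⟩
  · rintro ⟨a, _ | ⟨b, l⟩⟩ hw
    · simpa [word] using hword (0, [a]) (by simp [reduced])
    · rcases Nat.eq_zero_or_pos a with rfl | ha
      · simpa [word, ← mul_assoc, e_mul_e] using hword _ hw
      · rcases lt_or_ge a n with hn | hn
        · refine Submodule.mem_sup_right (hN.2 ?_)
          simpa [word, mul_assoc] using
            TwoSidedIdeal.mul_mem_right _ _ (y F ^ b * (l.map fun b => e F * y F ^ b).prod)
              (generator_mem_P (F := F) ha hn)
        · simpa [word, mul_assoc] using hword (0, a :: b :: l) (by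
            simpa [reduced, hn] using hw)
  · rintro ⟨a, l⟩ hw
    simpa [word, pow_succ', mul_assoc] using hword (a + 1, l) hw

/-- The index of the basis vector to which a reduced word takes the basis vector with index
`(n, u)`, for large `u`. -/
def orbit (n u : ℕ) : ℕ → List ℕ → ℕ × ℕ
  | a, [] => (a + n, u)
  | a, b :: l => (a, Nat.pair (orbit n u b l).1 (orbit n u b l).2 + 1)

theorem le_orbit_snd (n u a : ℕ) (l : List ℕ) : u ≤ (orbit n u a l).2 := by
  induction l generalizing a with
  | nil => rfl
  | cons b l ih =>
    exact ((ih b).trans (Nat.right_le_pair _ _)).trans (Nat.le_succ _)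

theorem orbit_injective (n u : ℕ) :
    Function.Injective fun w : ℕ × List ℕ => orbit n u w.1 w.2 := by
  have lt_cons : ∀ a b l, u < (orbit n u a (b :: l)).2 := fun a b l =>
    Nat.lt_succ_of_le ((le_orbit_snd n u b l).trans (Nat.right_le_pair _ _))
  rintro ⟨a, l⟩ ⟨a', l'⟩ h
  dsimp only at h
  induction l generalizing a a' l' with
  | nil =>
    cases l' with
    | nil => simpa [orbit] using h
    | cons b' l' => exact absurd (congrArg Prod.snd h) (lt_cons a' b' l').ne
  | cons b l ih =>
    cases l' with
    | nil => exact absurd (congrArg Prod.snd h) (lt_cons a b l).ne'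
    | cons b' l' =>
      simp only [orbit, Prod.mk.injEq, Nat.add_right_cancel_iff, Nat.pair_eq_pair] at h
      obtain ⟨rfl, h⟩ := h
      simpa using ih b b' l' (Prod.ext h.1 h.2)

theorem rep_word {n u : ℕ} (hn : 1 ≤ n) (a : ℕ) (l : List ℕ) (hl : (a, l) ∈ reduced n)
    (hu : ∀ b ∈ l, b + n < u) :
    rep F n (word F (a, l)) (Finsupp.single (n, u) 1) = Finsupp.single (orbit n u a l) 1 := by
  induction l generalizing a with
  | nil => simp [word, orbit, yOp_pow_single, add_comm]
  | cons b l ih =>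
    have hbl : (b, l) ∈ reduced n := fun c hc => hl c (by cases l <;> simp_all)
    have hw : word F (a, b :: l) = y F ^ a * (e F * word F (b, l)) := by simp [word, mul_assoc]
    have hub := hu b (by simp)
    have hb : n ≤ (orbit n u b l).1 ∧ (orbit n u b l).1 < u := by
      cases l with
      | nil => exact ⟨Nat.le_add_left _ _, hub⟩
      | cons c l => exact ⟨hl b (by simp), by simp only [orbit]; omega⟩
    have hT := T_fresh (hn.trans hb.1) hb.1 (hb.2.trans_le (le_orbit_snd n u b l))
    rw [hw, map_mul, map_mul, Module.End.mul_apply, Module.End.mul_apply,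
      ih b hbl fun c hc => hu c (by simp [hc])]
    simp [eOp_single, eBasis, hT, yOp_pow_single, orbit]

variable {F} in
theorem eq_zero_of_mem_span_word {n : ℕ} (hn : 1 ≤ n) {s : IdemAlg F}
    (hs : s ∈ Submodule.span F (word F '' reduced n)) (h0 : rep F n s = 0) : s = 0 := by
  obtain ⟨c, hc, rfl⟩ := (Finsupp.mem_span_image_iff_linearCombination F).1 hs
  rw [Finsupp.mem_supported] at hc
  obtain ⟨u, hu⟩ : ∃ u, ∀ w ∈ c.support, w.2.sum + n < u :=
    ⟨(c.support.sup fun w => w.2.sum + n) + 1, fun w hw =>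
      Nat.lt_succ_of_le (Finset.le_sup (f := fun w : ℕ × List ℕ => w.2.sum + n) hw)⟩
  have h1 : rep F n (Finsupp.linearCombination F (word F) c) (Finsupp.single (n, u) 1) =
      Finsupp.mapDomain (fun w : ℕ × List ℕ => orbit n u w.1 w.2) c := by
    rw [Finsupp.linearCombination_apply, map_finsuppSum, Finsupp.mapDomain, Finsupp.sum,
      Finsupp.sum, LinearMap.sum_apply]
    refine Finset.sum_congr rfl fun w hw => ?_
    rw [map_smul, LinearMap.smul_apply, rep_word F hn w.1 w.2 (hc hw) fun b hb =>
      (Nat.add_le_add_right (List.le_sum_of_mem hb) n).trans_lt (hu w hw)]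
    simp
  rw [h0, LinearMap.zero_apply] at h1
  have : c = 0 := Finsupp.mapDomain_injective (orbit_injective n u) (by simpa using h1.symm)
  rw [this, map_zero]

variable {F} in
theorem rep_eq_zero_iff {n : ℕ} (hn : 1 ≤ n) {r : IdemAlg F} : rep F n r = 0 ↔ r ∈ P F n := by
  refine ⟨fun h => ?_, rep_eq_zero_of_mem⟩
  obtain ⟨s, hs, p, hp, rfl⟩ := exists_word_span_add n r
  rw [map_add, rep_eq_zero_of_mem hp, add_zero] at h
  rwa [eq_zero_of_mem_span_word hn hs h, zero_add]

/-! ### Primitivity and strict inclusions -/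

theorem isLeftPrimitive_P {n : ℕ} (hn : 1 ≤ n) : IsLeftPrimitive (P F n) := by
  let φ : IdemAlg F →+* Module.End F (Mod F) := rep F n
  refine ⟨Mod F, Finsupp.instAddCommGroup, Module.compHom _ φ,
    isSimpleModule_compHom (S := IdemAlg F) (M := Mod F) (E := Module.End F (Mod F)) φ
      fun m hm m' => rep_transitive hm m', fun r => ?_⟩
  let := Module.compHom (Mod F) φ
  rw [Module.mem_annihilator, ← rep_eq_zero_iff hn]
  exact LinearMap.ext_iff

theorem isRightPrimitive_P {n : ℕ} (hn : 1 ≤ n) : IsRightPrimitive (P F n) := by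
  let φ : (IdemAlg F)ᵐᵒᵖ →+* Module.End F (Mod F) :=
    (rep F n : IdemAlg F →+* _).comp
      ((RingEquiv.opOp (IdemAlg F)).symm.toRingHom.comp (RingHom.op (rev F : IdemAlg F →+* _)))
  have hφ : ∀ r, φ (MulOpposite.op r) = rep F n (rev F r).unop := fun _ => rfl
  refine ⟨Mod F, Finsupp.instAddCommGroup, Module.compHom _ φ,
    isSimpleModule_compHom (S := (IdemAlg F)ᵐᵒᵖ) (M := Mod F) (E := Module.End F (Mod F)) φ
      fun m hm m' => ?_, fun r => ?_⟩
  · obtain ⟨r, hr⟩ := rep_transitive (n := n) hm m'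
    refine ⟨MulOpposite.op (rev F r).unop, ?_⟩
    rw [hφ, unop_rev_unop_rev]
    exact hr
  · let := Module.compHom (Mod F) φ
    rw [Module.mem_annihilator, ← unop_rev_mem_P_iff, ← rep_eq_zero_iff hn, ← hφ]
    exact LinearMap.ext_iff

theorem P_lt {m n : ℕ} (hm : 1 ≤ m) (hmn : m < n) : P F m < P F n := by
  refine lt_of_le_not_ge (P_mono F hmn.le) fun h => ?_
  have h0 := rep_eq_zero_of_mem (h (generator_mem_P hm hmn))
  have h1 := LinearMap.congr_fun h0 (Finsupp.single (0, m + 1) 1)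
  simp [eOp_single, eBasis, T_zero, yOp_pow_single, T_fresh hm le_rfl m.lt_succ_self] at h1

theorem e_mul_y_notMem_P (n : ℕ) : e F * y F ∉ P F n := by
  intro h
  have h1 := LinearMap.congr_fun (rep_eq_zero_of_mem h) (Finsupp.single (n, n + 2) 1)
  simp [eOp_single, eBasis, yOp_single, T_fresh (n.succ_pos) n.le_succ (n + 1).lt_succ_self] at h1

/-! ### The union -/

/-- The union of the chain `P 1 ⊆ P 2 ⊆ ⋯`. -/
noncomputable def unionP : TwoSidedIdeal (IdemAlg F) :=
  TwoSidedIdeal.mk' {x | ∃ n, 1 ≤ n ∧ x ∈ P F n}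
    ⟨1, le_rfl, TwoSidedIdeal.zero_mem _⟩
    (by
      rintro x z ⟨m, hm, hx⟩ ⟨n, _, hz⟩
      exact ⟨max m n, hm.trans (le_max_left _ _),
        TwoSidedIdeal.add_mem _ (P_mono F (le_max_left _ _) hx) (P_mono F (le_max_right _ _) hz)⟩)
    (by rintro x ⟨n, hn, hx⟩; exact ⟨n, hn, TwoSidedIdeal.neg_mem _ hx⟩)
    (by rintro x z ⟨n, hn, hz⟩; exact ⟨n, hn, TwoSidedIdeal.mul_mem_left _ _ _ hz⟩)
    (by rintro x z ⟨n, hn, hx⟩; exact ⟨n, hn, TwoSidedIdeal.mul_mem_right _ _ _ hx⟩)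

variable {F} in
theorem mem_unionP {x : IdemAlg F} : x ∈ unionP F ↔ ∃ n, 1 ≤ n ∧ x ∈ P F n := by
  simp [unionP]

variable {F} in
theorem unionP_le_iff {I : TwoSidedIdeal (IdemAlg F)} :
    unionP F ≤ I ↔ ∀ i, 1 ≤ i → e F * y F ^ i * e F ∈ I := by
  constructor
  · exact fun h i hi => h (mem_unionP.2 ⟨i + 1, by omega, generator_mem_P hi i.lt_succ_self⟩)
  · intro h x hx
    obtain ⟨n, _, hx⟩ := mem_unionP.1 hx
    exact P_le_iff.2 (fun i h1 _ => h i h1) hx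

/-- An element of `e R e` that starts with `e * y` or ends with `y * e` lies in the union: the
first `e` met on the way splits off a factor `e * y ^ i * e` with `i ≥ 1`. -/
theorem corner_mem (s : IdemAlg F) {j k : ℕ} (h : 1 ≤ j + k) :
    e F * y F ^ j * s * (y F ^ k * e F) ∈ unionP F := by
  let N : Submodule F (IdemAlg F) := (unionP F).asIdeal.restrictScalars F
  have gen : ∀ i, 1 ≤ i → e F * y F ^ i * e F ∈ unionP F := unionP_le_iff.1 le_rfl
  have := mem_of_mul_left_closed (N := ⨅ j : {j // 1 ≤ j + k}, N.comap
    (LinearMap.mulRight F (y F ^ k * e F) ∘ₗ LinearMap.mulLeft F (e F * y F ^ j.1)))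
    ?_ ?_ ?_ s
  · exact (Submodule.mem_iInf _).1 this ⟨j, h⟩
  all_goals
    simp only [Submodule.mem_iInf, Subtype.forall, Submodule.mem_comap, LinearMap.comp_apply,
      LinearMap.mulLeft_apply, LinearMap.mulRight_apply, N, Submodule.restrictScalars_mem,
      TwoSidedIdeal.mem_asIdeal]
  · intro j hj
    simpa [pow_add, mul_assoc] using gen (j + k) hj
  · intro x hx j hj
    rcases Nat.eq_zero_or_pos j with rfl | hj0
    · simpa [← mul_assoc, e_mul_e] using hx 0 hj
    · simpa [mul_assoc] using
        TwoSidedIdeal.mul_mem_right _ _ (x * (y F ^ k * e F)) (gen j hj0)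
  · intro x hx j hj
    simpa [pow_succ, mul_assoc] using hx (j + 1) (by omega)

variable {F} in
theorem mul_mul_mem_sandwich₂ (a b r s t : IdemAlg F) :
    r * a * s * b * t ∈ sandwich₂ F a b :=
  Submodule.mul_mem_mul (Submodule.mul_mem_mul (Submodule.mul_mem_mul (Submodule.mul_mem_mul
    trivial (Submodule.mem_span_singleton_self a)) trivial)
    (Submodule.mem_span_singleton_self b)) trivial

variable {F} in
theorem sandwich₂_le_iff {a b : IdemAlg F} {N : Submodule F (IdemAlg F)} :
    sandwich₂ F a b ≤ N ↔ ∀ r s t, r * a * s * b * t ∈ N := by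
  refine ⟨fun h r s t => h (mul_mul_mem_sandwich₂ a b r s t), fun h => ?_⟩
  rw [sandwich₂, ← Submodule.span_univ, Submodule.span_mul_span, Submodule.span_mul_span,
    Submodule.span_mul_span, Submodule.span_mul_span, Submodule.span_le]
  rintro _ ⟨_, ⟨_, ⟨_, ⟨r, -, _, rfl, rfl⟩, s, -, rfl⟩, _, rfl, rfl⟩, t, -, rfl⟩
  exact h r s t

/-- `R a R b R` as a two-sided ideal. -/
noncomputable def sandwichIdeal (a b : IdemAlg F) : TwoSidedIdeal (IdemAlg F) :=
  TwoSidedIdeal.mk' (sandwich₂ F a b) (zero_mem _) add_mem neg_mem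
    (fun {x z} hz => by
      have : sandwich₂ F a b ≤ (sandwich₂ F a b).comap (LinearMap.mulLeft F x) :=
        sandwich₂_le_iff.2 fun r s t => by
          simpa [mul_assoc] using mul_mul_mem_sandwich₂ a b (x * r) s t
      exact this hz)
    (fun {x z} hx => by
      have : sandwich₂ F a b ≤ (sandwich₂ F a b).comap (LinearMap.mulRight F z) :=
        sandwich₂_le_iff.2 fun r s t => by
          simpa [mul_assoc] using mul_mul_mem_sandwich₂ a b r s (t * z)
      exact this hx)

variable {F} in
theorem mem_sandwichIdeal {a b x : IdemAlg F} : x ∈ sandwichIdeal F a b ↔ x ∈ sandwich₂ F a b :=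
  TwoSidedIdeal.mem_mk' ..

variable {F} in
theorem coe_unionP_eq_sandwich₂ {a b : IdemAlg F}
    (h1 : ∀ s, a * s * b ∈ unionP F)
    (h2 : ∀ i, 1 ≤ i → e F * y F ^ i * e F ∈ sandwich₂ F a b) :
    (unionP F : Set (IdemAlg F)) = sandwich₂ F a b := by
  apply Set.Subset.antisymm
  · have : unionP F ≤ sandwichIdeal F a b := unionP_le_iff.2 fun i hi =>
      mem_sandwichIdeal.2 (h2 i hi)
    exact fun x hx => mem_sandwichIdeal.1 (this hx)
  · have : sandwich₂ F a b ≤ (unionP F).asIdeal.restrictScalars F :=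
      sandwich₂_le_iff.2 fun r s t => by
        simpa [mul_assoc] using TwoSidedIdeal.mul_mem_right _ _ t
          (TwoSidedIdeal.mul_mem_left _ r _ (h1 s))
    exact this

theorem coe_unionP_eq_eyReR :
    (unionP F : Set (IdemAlg F)) = sandwich₂ F (e F * y F) (e F) := by
  refine coe_unionP_eq_sandwich₂ (fun s => ?_) fun i hi => ?_
  · simpa using corner_mem F s (j := 1) (k := 0) le_rfl
  · obtain ⟨i, rfl⟩ := Nat.exists_eq_add_of_le' hi
    simpa [pow_succ', mul_assoc] using
      mul_mul_mem_sandwich₂ (e F * y F) (e F) 1 (y F ^ i) 1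

theorem coe_unionP_eq_eRyeR :
    (unionP F : Set (IdemAlg F)) = sandwich₂ F (e F) (y F * e F) := by
  refine coe_unionP_eq_sandwich₂ (fun s => ?_) fun i hi => ?_
  · simpa using corner_mem F s (j := 0) (k := 1) le_rfl
  · obtain ⟨i, rfl⟩ := Nat.exists_eq_add_of_le' hi
    simpa [pow_succ, mul_assoc] using
      mul_mul_mem_sandwich₂ (e F) (y F * e F) 1 (y F ^ i) 1

theorem ey_mul_mul_ey_mem (r : IdemAlg F) : e F * y F * r * (e F * y F) ∈ unionP F := by
  simpa [mul_assoc] using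
    TwoSidedIdeal.mul_mem_right _ _ (y F) (corner_mem F r (j := 1) (k := 0) le_rfl)

theorem sandwich₁_sq_le :
    sandwich₁ F (e F * y F) ^ 2 ≤ (unionP F).asIdeal.restrictScalars F := by
  rw [sq, sandwich₁, ← Submodule.span_univ, Submodule.span_mul_span, Submodule.span_mul_span,
    Submodule.span_mul_span, Submodule.span_le]
  rintro _ ⟨_, ⟨_, ⟨r, -, _, rfl, rfl⟩, s, -, rfl⟩, _, ⟨_, ⟨r', -, _, rfl, rfl⟩, s', -, rfl⟩, rfl⟩
  have h := TwoSidedIdeal.mul_mem_right _ _ s'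
    (TwoSidedIdeal.mul_mem_left _ r _ (ey_mul_mul_ey_mem F (s * r')))
  simpa [mul_assoc] using h

end ChainEx

theorem mainTheorem8 (F : Type u) [Field F] :
    (∀ n : ℕ, 1 ≤ n →
      ChainEx.IsPrime (ChainEx.P F n) ∧
      ChainEx.IsLeftPrimitive (ChainEx.P F n) ∧
      ChainEx.IsRightPrimitive (ChainEx.P F n)) ∧
    (∀ m n : ℕ, 1 ≤ m → m < n → ChainEx.P F m < ChainEx.P F n) ∧
    ∃ U : TwoSidedIdeal (ChainEx.IdemAlg F),
      (U : Set (ChainEx.IdemAlg F)) =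
        ⋃ n ∈ Set.Ici (1 : ℕ), (ChainEx.P F n : Set (ChainEx.IdemAlg F)) ∧
      (U : Set (ChainEx.IdemAlg F)) =
        ChainEx.sandwich₂ F (ChainEx.e F * ChainEx.y F) (ChainEx.e F) ∧
      (U : Set (ChainEx.IdemAlg F)) =
        ChainEx.sandwich₂ F (ChainEx.e F) (ChainEx.y F * ChainEx.e F) ∧
      ((ChainEx.sandwich₁ F (ChainEx.e F * ChainEx.y F) ^ 2 :
          Submodule F (ChainEx.IdemAlg F)) : Set (ChainEx.IdemAlg F)) ⊆ U ∧
      ChainEx.e F * ChainEx.y F ∉ U ∧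
      ¬ ChainEx.IsSemiprime U := by

  refine ⟨fun n hn => ⟨(ChainEx.isLeftPrimitive_P F hn).isPrime, ChainEx.isLeftPrimitive_P F hn,
    ChainEx.isRightPrimitive_P F hn⟩, fun m n => ChainEx.P_lt F, ChainEx.unionP F, ?_,
    ChainEx.coe_unionP_eq_eyReR F, ChainEx.coe_unionP_eq_eRyeR F, ChainEx.sandwich₁_sq_le F, ?_, ?_⟩
  · ext x
    simp [ChainEx.mem_unionP]
  · rw [ChainEx.mem_unionP]
    rintro ⟨n, _, h⟩
    exact ChainEx.e_mul_y_notMem_P F n h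
  · intro h
    obtain ⟨n, _, h⟩ := ChainEx.mem_unionP.1 (h _ (ChainEx.ey_mul_mul_ey_mem F))
    exact ChainEx.e_mul_y_notMem_P F n h
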